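/- Fix $1<\gamma<2$ and put $a=\sqrt{\gamma-1}$. Let $A:(0,\infty)\to(0,\infty)$ be $C^1$ with $A'>0$, and consider the one-dimensional relativistic Euler equations (speed of light $1$) in the ultra-relativistic limit, $U_t+F(U)_x=0$ with $$U=\Big(\tfrac{n}{\sqrt{1-v^2}},\ (\rho+p)\tfrac{v}{1-v^2},\ (\rho+p)\tfrac{v^2}{1-v^2}+\rho\Big),\qquad F=\Big(\tfrac{nv}{\sqrt{1-v^2}},\ (\rho+p)\tfrac{v^2}{1-v^2}+p,\ (\rho+p)\tfrac{v}{1-v^2}\Big),$$ where $\epsilon(n,S)=A(S)n^{\gamma-1}$, $\rho=n\epsilon$, $p=n^2\,\partial\epsilon/\partial n=(\gamma-1)\rho$, for states with $\rho>0$, $-1<v<1$, $S>0$. The characteristic speeds are $\lambda_1=\frac{v-a}{1-va}$, $\lambda_2=v$, $\lambda_3=\frac{v+a}{1+va}$. Put $$r=\tfrac12\ln\tfrac{1+v}{1-v}-\tfrac{a}{1+a^2}\ln\rho,\qquad s=\tfrac12\ln\tfrac{1+v}{1-v}+\tfrac{a}{1+a^2}\ln\rho,\qquad \Sigma=\ln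 A(S).$$ A solution of the Riemann problem $\langle U_L,U_R\rangle$ consists of states $\overline U,\overline U'$ such that $U_L$ is joined to $\overline U$ by a 1-wave, $\overline U$ to $\overline U'$ by an entropy wave (a contact discontinuity satisfying the Rankine–Hugoniot conditions with speed $v$, the velocity being the same on both sides), and $\overline U'$ to $U_R$ by a 3-wave. An $i$-wave ($i=1,3$) from $V$ to $W$ is trivial ($V=W$), or a shock (the Rankine–Hugoniot conditions hold with some speed $c$ satisfying $\lambda_i(W)<c<\lambda_i(V)$), or a rarefaction ($W$ lies on the integral curve of the $i$-th characteristic field through $V$, and $\lambda_i(V)<\lambda_i(W)$). For such a solution let $\alpha\ge 0$ be the strength of the 1-shock, i.e. the decrease of $r$ across the 1-wave if $r$ decreases and $0$ otherwise; let $\beta\ge 0$ be the strength of the 3-shock, i.e. the decrease of $s$ across the 3-wave if $s$ decreases and $0$ otherwise; let $\delta=\Sigma(\overline U')-\Sigma(\overline U)$ be the strength of the entropy wave; and let $\delta_\alpha,\delta_\beta\ge 0$ be the absolute changes of $\Sigma$ across the 1-shock and the 3-shock ($0$ if there is no such shock). **Proposition.** For every compact set $\Omega$ in the $rs$-plane there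 is a constant $M>0$, depending only on $\Omega$ and $\gamma$, such that for every $A$ as above and all states $U_L,U_M,U_R$ (with any values of $\Sigma$) whose $(r,s)$-coordinates lie in $\Omega$, the solutions of the Riemann problems $\langle U_L,U_M\rangle$, $\langle U_M,U_R\rangle$, $\langle U_L,U_R\rangle$, whose wave strengths carry the subscript $1$, the subscript $2$ and a prime respectively, satisfy $$|\delta'|-|\delta_1|-|\delta_2|+(\delta_{\alpha_1}+\delta_{\alpha_2}-\delta_{\alpha'})+(\delta_{\beta_1}+\delta_{\beta_2}-\delta_{\beta'})\le -M(\mathcal A+\mathcal B),$$ where $\mathcal A=\alpha'-\alpha_1-\alpha_2$ and $\mathcal B=\beta'-\beta_1-\beta_2$. -/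

import Mathlib

open Set

noncomputable section

/-- The admissible functions `A` in the equations of state `ε(n, S) = A(S) n ^ (γ - 1)`:
positive and continuously differentiable, with positive derivative, on `S > 0`.
Values of `A` at `S ≤ 0` play no role. -/
structure AdmissibleEOS (A : ℝ → ℝ) : Prop where
  pos : ∀ S, 0 < S → 0 < A S
  contDiffOn : ContDiffOn ℝ 1 A (Ioi 0)
  deriv_pos : ∀ S, 0 < S → 0 < deriv A S

/-- A fluid state: baryon number density `n`, velocity `v` (speed of light `1`),
specific entropy `S`. -/
@[ext]
structure FluidState where
  n : ℝ
  v : ℝ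
  S : ℝ

namespace FluidState

/-- Physical states.  As `ρ = A(S) n ^ γ`, `n > 0` is the same as `ρ > 0` here. -/
def Physical (U : FluidState) : Prop := 0 < U.n ∧ -1 < U.v ∧ U.v < 1 ∧ 0 < U.S

end FluidState

/-- Specific internal energy `ε(n, S) = A(S) n ^ (γ - 1)`. -/
def internalEnergy (γ : ℝ) (A : ℝ → ℝ) (n S : ℝ) : ℝ := A S * n ^ (γ - 1)

/-- Proper energy density in the ultra-relativistic limit, `ρ = n ε`. -/
def energyDensity (γ : ℝ) (A : ℝ → ℝ) (U : FluidState) : ℝ :=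
  U.n * internalEnergy γ A U.n U.S

/-- Pressure from the second law of thermodynamics, `p = n² ∂ε/∂n`;
for physical states this is `(γ - 1) ρ`. -/
def pressure (γ : ℝ) (A : ℝ → ℝ) (U : FluidState) : ℝ :=
  U.n ^ 2 * deriv (fun m => internalEnergy γ A m U.S) U.n

/-- Conserved quantities: baryon number, momentum, energy. -/
def conserved (γ : ℝ) (A : ℝ → ℝ) (U : FluidState) : Fin 3 → ℝ :=
  ![U.n / √(1 - U.v ^ 2),
    (energyDensity γ A U + pressure γ A U) * (U.v / (1 - U.v ^ 2)),
    (energyDensity γ A U + pressure γ A U) * (U.v ^ 2 / (1 - U.v ^ 2)) + energyDensity γ A U]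

/-- The corresponding fluxes. -/
def flux (γ : ℝ) (A : ℝ → ℝ) (U : FluidState) : Fin 3 → ℝ :=
  ![U.n * U.v / √(1 - U.v ^ 2),
    (energyDensity γ A U + pressure γ A U) * (U.v ^ 2 / (1 - U.v ^ 2)) + pressure γ A U,
    (energyDensity γ A U + pressure γ A U) * (U.v / (1 - U.v ^ 2))]

/-- Sound speed `a = √(dp/dρ) = √(γ - 1)`. -/
def soundSpeed (γ : ℝ) : ℝ := √(γ - 1)

/-- First characteristic speed. -/
def lambda1 (γ : ℝ) (U : FluidState) : ℝ :=
  (U.v - soundSpeed γ) / (1 - U.v * soundSpeed γ)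

/-- Third characteristic speed.  (The second one is the fluid velocity `v`.) -/
def lambda3 (γ : ℝ) (U : FluidState) : ℝ :=
  (U.v + soundSpeed γ) / (1 + U.v * soundSpeed γ)

/-- The Riemann invariant `r`. -/
def invR (γ : ℝ) (A : ℝ → ℝ) (U : FluidState) : ℝ :=
  1 / 2 * Real.log ((1 + U.v) / (1 - U.v))
    - soundSpeed γ / (1 + soundSpeed γ ^ 2) * Real.log (energyDensity γ A U)

/-- The Riemann invariant `s`. -/
def invS (γ : ℝ) (A : ℝ → ℝ) (U : FluidState) : ℝ :=
  1 / 2 * Real.log ((1 + U.v) / (1 - U.v))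
    + soundSpeed γ / (1 + soundSpeed γ ^ 2) * Real.log (energyDensity γ A U)

/-- The entropy coordinate `Σ = ln A(S)`. -/
def entropySigma (A : ℝ → ℝ) (U : FluidState) : ℝ := Real.log (A U.S)

/-- The Rankine-Hugoniot jump conditions for a discontinuity of speed `c`. -/
def RankineHugoniot (γ : ℝ) (A : ℝ → ℝ) (c : ℝ) (L R : FluidState) : Prop :=
  c • (conserved γ A R - conserved γ A L) = flux γ A R - flux γ A L

/-- `L` (left) and `R` (right) are separated by a shock of the family with characteristic
speed `lam`: the jump conditions and the Lax entropy condition hold. -/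
def IsShock (γ : ℝ) (A : ℝ → ℝ) (lam : FluidState → ℝ) (L R : FluidState) : Prop :=
  ∃ c : ℝ, RankineHugoniot γ A c L R ∧ lam R < c ∧ c < lam L

/-- `L` (left) and `R` (right) are joined by a rarefaction wave of the family with
characteristic speed `lam`: some curve of physical states runs from `L` to `R`
along the characteristic field, and `lam L < lam R`.  That the
velocity of the curve `w = (n, v, S)` is an eigenvector of `dF/dU` for the eigenvalue `lam`
is expressed by `d/dt F(w(t)) = lam(w(t)) d/dt U(w(t))`. -/
def IsRarefaction (γ : ℝ) (A : ℝ → ℝ) (lam : FluidState → ℝ) (L R : FluidState) : Prop :=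
  lam L < lam R ∧
  ∃ n v S : ℝ → ℝ,
    DifferentiableOn ℝ n (Icc 0 1) ∧ DifferentiableOn ℝ v (Icc 0 1) ∧
    DifferentiableOn ℝ S (Icc 0 1) ∧
    (⟨n 0, v 0, S 0⟩ : FluidState) = L ∧ (⟨n 1, v 1, S 1⟩ : FluidState) = R ∧
    ∀ t ∈ Icc (0 : ℝ) 1,
      (⟨n t, v t, S t⟩ : FluidState).Physical ∧
      derivWithin (fun τ => flux γ A ⟨n τ, v τ, S τ⟩) (Icc 0 1) t =
        lam ⟨n t, v t, S t⟩ •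
          derivWithin (fun τ => conserved γ A ⟨n τ, v τ, S τ⟩) (Icc 0 1) t

/-- A (possibly trivial) elementary wave of a genuinely nonlinear family. -/
def IsNonlinearWave (γ : ℝ) (A : ℝ → ℝ) (lam : FluidState → ℝ) (L R : FluidState) : Prop :=
  L = R ∨ IsRarefaction γ A lam L R ∨ IsShock γ A lam L R

/-- A (possibly trivial) entropy wave: a discontinuity travelling with the fluid. -/
def IsEntropyWave (γ : ℝ) (A : ℝ → ℝ) (L R : FluidState) : Prop :=
  L.v = R.v ∧ RankineHugoniot γ A L.v L R

/-- A solution of the Riemann problem with data `L`, `R` by elementary waves: a 1-wave from `L`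
to `mid`, an entropy wave from `mid` to `mid'`, a 3-wave from `mid'` to `R`. -/
structure RiemannSolution (γ : ℝ) (A : ℝ → ℝ) (L R : FluidState) where
  mid : FluidState
  mid' : FluidState
  physical_mid : mid.Physical
  physical_mid' : mid'.Physical
  wave1 : IsNonlinearWave γ A (lambda1 γ) L mid
  wave2 : IsEntropyWave γ A mid mid'
  wave3 : IsNonlinearWave γ A (lambda3 γ) mid' R

namespace RiemannSolution

variable {γ : ℝ} {A : ℝ → ℝ} {L R : FluidState}

/-- Signed strength of the 1-wave: the change of `r` (negative for a shock). -/
def eps1 (w : RiemannSolution γ A L R) : ℝ := invR γ A w.mid - invR γ A L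

/-- Signed strength of the 3-wave: the change of `s` (negative for a shock). -/
def eps3 (w : RiemannSolution γ A L R) : ℝ := invS γ A R - invS γ A w.mid'

/-- Strength `α` of the 1-shock (`0` if there is none). -/
def alpha (w : RiemannSolution γ A L R) : ℝ := if w.eps1 ≤ 0 then -w.eps1 else 0

/-- Strength `β` of the 3-shock (`0` if there is none). -/
def beta (w : RiemannSolution γ A L R) : ℝ := if w.eps3 ≤ 0 then -w.eps3 else 0

/-- Strength `δ` of the entropy wave: the change of `Σ` across it. -/
def delta (w : RiemannSolution γ A L R) : ℝ := entropySigma A w.mid' - entropySigma A w.mid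

/-- `δ_α`: the absolute change of `Σ` across the 1-shock (`0` if there is none). -/
def deltaAlpha (w : RiemannSolution γ A L R) : ℝ :=
  if 0 < w.alpha then |entropySigma A w.mid - entropySigma A L| else 0

/-- `δ_β`: the absolute change of `Σ` across the 3-shock (`0` if there is none). -/
def deltaBeta (w : RiemannSolution γ A L R) : ℝ :=
  if 0 < w.beta then |entropySigma A R - entropySigma A w.mid'| else 0

end RiemannSolution

end

noncomputable section

/-! ### Comparing two functions through the ratio of their derivatives. -/

section SlopeComparison

/-! Every shock is described by one number `k` in `[1, 1/a)`. Its strength p, its jump h in the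
opposite Riemann invariant and its jump g in Σ are explicit functions of `k` vanishing at `k = 1`.
The ratios h'/p' = ((k-1)/(k+1))² and g'/p' = const·(k-1)²/k increase with `k` and are bounded by
their values θ < 1 and C at `k = 1/a`. So h and g are convex functions of p, and h(k₁)+h(k₂)-h(k₃)
is at most μ(p(k₁)+p(k₂)-p(k₃)) with 0 ≤ μ ≤ θ; likewise for g with C (`exists_slope_shockCross`,
`exists_slope_shockEntropy`).

Among r, s, Σ, rarefactions change only the invariant of their own family and entropy waves only Σ.
The total jumps of r and s from `UL` to `UR` add up through `UM`, so an increase of shock strength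
in one family is paid for by the h-terms of the other. With u = -𝒜 and w = -ℬ: if u < 0 then -u ≤
θw, and symmetrically. Hence u + w ≥ 0, and both u and w are at most (u+w)/(1-θ)
(`two_mul_le_of_interaction`).

Let X and Y be the decreases of the total Σ-jumps of the 1-shocks and of the 3-shocks. Adding up Σ
gives δ' = δ₁ + δ₂ + X - Y, so the left side is at most |X-Y| + X + Y = 2 max(X, Y). Since X ≤ νu
and Y ≤ ν'w with 0 ≤ ν, ν' ≤ C, the constant M = 2C/(1-θ) works. -/

theorem le_of_hasDerivAt_nonneg {b : ℝ} {q q' : ℝ → ℝ} {k₁ k₂ : ℝ}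
    (hq : ∀ k ∈ Ico 1 b, HasDerivAt q (q' k) k) (h₁ : k₁ ∈ Ico 1 b) (h₂ : k₂ ∈ Ico 1 b)
    (hq' : ∀ k ∈ Icc k₁ k₂, 0 ≤ q' k) (h₁₂ : k₁ ≤ k₂) : q k₁ ≤ q k₂ := by
  have hsub : ∀ k ∈ Icc k₁ k₂, k ∈ Ico 1 b := fun k hk =>
    ⟨h₁.1.trans hk.1, hk.2.trans_lt h₂.2⟩
  refine monotoneOn_of_deriv_nonneg (convex_Icc _ _)
    (fun k hk => (hq k (hsub k hk)).continuousAt.continuousWithinAt)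
    (fun k hk => (hq k (hsub k (interior_subset hk))).differentiableAt.differentiableWithinAt)
    (fun k hk => ?_) (left_mem_Icc.2 h₁₂) (right_mem_Icc.2 h₁₂) h₁₂
  rw [(hq k (hsub k (interior_subset hk))).deriv]
  exact hq' k (interior_subset hk)

/-- If `h' = m p'` with `p' ≥ 0` and `m` monotone, the increments of `h` are bounded by those
of `p` times the extreme values of `m`. -/
theorem increment_bounds_of_hasDerivAt {b : ℝ} {p h m p' : ℝ → ℝ}
    (hp : ∀ k ∈ Ico 1 b, HasDerivAt p (p' k) k)
    (hh : ∀ k ∈ Ico 1 b, HasDerivAt h (m k * p' k) k)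
    (hp' : ∀ k ∈ Ico 1 b, 0 ≤ p' k) (hm : MonotoneOn m (Ico 1 b))
    {k₁ k₂ : ℝ} (h₁ : k₁ ∈ Ico 1 b) (h₂ : k₂ ∈ Ico 1 b) (h₁₂ : k₁ ≤ k₂) :
    m k₁ * (p k₂ - p k₁) ≤ h k₂ - h k₁ ∧ h k₂ - h k₁ ≤ m k₂ * (p k₂ - p k₁) := by
  have hsub : ∀ k ∈ Icc k₁ k₂, k ∈ Ico 1 b := fun k hk =>
    ⟨h₁.1.trans hk.1, hk.2.trans_lt h₂.2⟩
  -- Both bounds say that some combination of `h` and `p` is nondecreasing: `h - m k₁ * p` for the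
  -- lower one, `m k₂ * p - h` for the upper one.
  have key : ∀ c d : ℝ, (∀ k ∈ Icc k₁ k₂, 0 ≤ (c * m k + d) * p' k) →
      c * h k₁ + d * p k₁ ≤ c * h k₂ + d * p k₂ := by
    intro c d hcd
    refine le_of_hasDerivAt_nonneg (q := fun k => c * h k + d * p k)
      (q' := fun k => (c * m k + d) * p' k) (fun k hk => ?_) h₁ h₂ hcd h₁₂
    exact (((hh k hk).const_mul c).add ((hp k hk).const_mul d)).congr_deriv (by ring)
  constructor
  · have := key 1 (-m k₁) fun k hk => mul_nonneg
      (by linarith [hm h₁ (hsub k hk) hk.1]) (hp' k (hsub k hk))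
    linarith
  · have := key (-1) (m k₂) fun k hk => mul_nonneg
      (by linarith [hm (hsub k hk) h₂ hk.2]) (hp' k (hsub k hk))
    linarith

/-- A quantitative form of superadditivity of `h` as a (convex) function of `p`. -/
theorem exists_slope_of_hasDerivAt {b C : ℝ} {p h m p' : ℝ → ℝ}
    (hp : ∀ k ∈ Ico 1 b, HasDerivAt p (p' k) k)
    (hh : ∀ k ∈ Ico 1 b, HasDerivAt h (m k * p' k) k)
    (hp' : ∀ k ∈ Ico 1 b, 0 ≤ p' k) (hm : MonotoneOn m (Ico 1 b))
    (hm0 : ∀ k ∈ Ico 1 b, 0 ≤ m k) (hmC : ∀ k ∈ Ico 1 b, m k ≤ C)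
    (hp1 : p 1 = 0) (hh1 : h 1 = 0)
    {k₁ k₂ k₃ : ℝ} (h₁ : k₁ ∈ Ico 1 b) (h₂ : k₂ ∈ Ico 1 b) (h₃ : k₃ ∈ Ico 1 b) :
    ∃ μ, 0 ≤ μ ∧ μ ≤ C ∧ h k₁ + h k₂ - h k₃ ≤ μ * (p k₁ + p k₂ - p k₃) := by
  wlog h₁₂ : k₁ ≤ k₂ generalizing k₁ k₂
  · obtain ⟨μ, hμ⟩ := this h₂ h₁ (le_of_not_ge h₁₂)
    exact ⟨μ, by rwa [add_comm (h k₁), add_comm (p k₁)]⟩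
  have inc {k k' : ℝ} (hk : k ∈ Ico 1 b) (hk' : k' ∈ Ico 1 b) (hkk' : k ≤ k') :=
    increment_bounds_of_hasDerivAt hp hh hp' hm hk hk' hkk'
  have one_mem : (1 : ℝ) ∈ Ico 1 b := ⟨le_rfl, h₁.1.trans_lt h₁.2⟩
  have hp_nonneg : 0 ≤ p k₁ := hp1 ▸ le_of_hasDerivAt_nonneg hp one_mem h₁
    (fun k hk => hp' k ⟨hk.1, hk.2.trans_lt h₁.2⟩) h₁.1
  have e₁ : h k₁ ≤ m k₂ * p k₁ := by
    have := (inc one_mem h₁ h₁.1).2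
    rw [hp1, hh1, sub_zero, sub_zero] at this
    exact this.trans (mul_le_mul_of_nonneg_right (hm h₁ h₂ h₁₂) hp_nonneg)
  -- The slope at the larger of `k₁`, `k₂`: the graph of `h` over `p` lies above its tangent at
  -- `k₂`, on whichever side `k₃` falls.
  refine ⟨m k₂, hm0 k₂ h₂, hmC k₂ h₂, ?_⟩
  rcases le_total k₂ k₃ with h₂₃ | h₂₃
  · linarith [(inc h₂ h₃ h₂₃).1]
  · linarith [(inc h₃ h₂ h₂₃).2]

end SlopeComparison

/-! ### Explicit shock curves and their slopes. -/

section ShockParametrization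

/-- Decrease of rapidity across a shock; `k` is the ratio of the velocity ahead of the shock, in
the frame of the shock, to the sound speed `a`. -/
def shockRapidity (a k : ℝ) : ℝ :=
  1 / 2 * Real.log ((1 + a * k) / (1 - a * k)) - 1 / 2 * Real.log ((k + a) / (k - a))

/-- Logarithm of the density ratio across a shock. -/
def shockCompression (a k : ℝ) : ℝ := Real.log ((k ^ 2 - a ^ 2) / (1 - a ^ 2 * k ^ 2))

/-- Decrease across a shock of the Riemann invariant of its own family. -/
def shockStrength (a k : ℝ) : ℝ := shockRapidity a k + a / (1 + a ^ 2) * shockCompression a k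

/-- Decrease across a shock of the Riemann invariant of the opposite family. -/
def shockCross (a k : ℝ) : ℝ := shockRapidity a k - a / (1 + a ^ 2) * shockCompression a k

/-- Increase of `Σ` across a shock. -/
def shockEntropy (a k : ℝ) : ℝ :=
  (1 - a ^ 2) / 2 * shockCompression a k - (1 + a ^ 2) * Real.log k

variable {a k : ℝ}

theorem shock_parameter_pos (ha : 0 < a) (ha1 : a < 1) (hk : k ∈ Ico 1 (1 / a)) :
    0 < 1 - a * k ∧ 0 < k - a ∧ 0 < k := by
  have h := (lt_div_iff₀ ha).1 hk.2
  exact ⟨by linarith, by linarith [hk.1], by linarith [hk.1]⟩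

theorem shockStrength_one (ha1 : a < 1) (ha : 0 < a) : shockStrength a 1 = 0 := by
  have : 1 - a ^ 2 ≠ 0 := by nlinarith
  simp [shockStrength, shockRapidity, shockCompression, this]

theorem shockCross_one (ha1 : a < 1) (ha : 0 < a) : shockCross a 1 = 0 := by
  have : 1 - a ^ 2 ≠ 0 := by nlinarith
  simp [shockCross, shockRapidity, shockCompression, this]

theorem shockEntropy_one (ha1 : a < 1) (ha : 0 < a) : shockEntropy a 1 = 0 := by
  have : 1 - a ^ 2 ≠ 0 := by nlinarith
  simp [shockEntropy, shockCompression, this]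

theorem hasDerivAt_shockRapidity (ha : 0 < a) (ha1 : a < 1) (hk : k ∈ Ico 1 (1 / a)) :
    HasDerivAt (shockRapidity a)
      (a * (1 - a ^ 2) * (1 + k ^ 2) / ((1 - a ^ 2 * k ^ 2) * (k ^ 2 - a ^ 2))) k := by
  obtain ⟨h1, h2, h3⟩ := shock_parameter_pos ha ha1 hk
  have h4 : 0 < 1 + a * k := by positivity
  have h5 : 0 < k + a := by positivity
  have e1 : 1 - a ^ 2 * k ^ 2 = (1 - a * k) * (1 + a * k) := by ring
  have e2 : k ^ 2 - a ^ 2 = (k - a) * (k + a) := by ring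
  have d1 : HasDerivAt (fun k : ℝ => a * k) a k := by
    simpa using (hasDerivAt_id k).const_mul a
  have d := (((((d1.const_add 1).div (d1.const_sub 1) h1.ne').log
    (div_pos h4 h1).ne').const_mul (1 / 2)).sub
    (((((hasDerivAt_id k).add_const a).div ((hasDerivAt_id k).sub_const a) h2.ne').log
    (div_pos h5 h2).ne').const_mul (1 / 2)))
  refine d.congr_deriv ?_
  simp only [id, Pi.div_apply]
  rw [e1, e2]
  field_simp
  ring

theorem hasDerivAt_shockCompression (ha : 0 < a) (ha1 : a < 1) (hk : k ∈ Ico 1 (1 / a)) :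
    HasDerivAt (shockCompression a)
      (2 * k * (1 - a ^ 4) / ((1 - a ^ 2 * k ^ 2) * (k ^ 2 - a ^ 2))) k := by
  obtain ⟨h1, h2, h3⟩ := shock_parameter_pos ha ha1 hk
  have h4 : 0 < 1 - a ^ 2 * k ^ 2 := by nlinarith [mul_pos ha h3]
  have h5 : 0 < k ^ 2 - a ^ 2 := by nlinarith
  have d1 : HasDerivAt (fun k : ℝ => k ^ 2) (2 * k) k := by
    simpa using hasDerivAt_pow 2 k
  have d := ((d1.sub_const (a ^ 2)).div ((d1.const_mul (a ^ 2)).const_sub 1) h4.ne').log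
    (div_pos h5 h4).ne'
  refine d.congr_deriv ?_
  simp only [Pi.div_apply]
  field_simp
  ring

/-- Derivative of the shock strength in the parameter `k`. -/
def shockStrengthDeriv (a k : ℝ) : ℝ :=
  a * (1 - a ^ 2) * (k + 1) ^ 2 / ((1 - a ^ 2 * k ^ 2) * (k ^ 2 - a ^ 2))

theorem shockStrengthDeriv_nonneg (ha : 0 < a) (ha1 : a < 1) (hk : k ∈ Ico 1 (1 / a)) :
    0 ≤ shockStrengthDeriv a k := by
  obtain ⟨h1, h2, h3⟩ := shock_parameter_pos ha ha1 hk
  have h4 : 0 < 1 - a ^ 2 * k ^ 2 := by nlinarith [mul_pos ha h3]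
  have h5 : 0 < k ^ 2 - a ^ 2 := by nlinarith
  have h6 : 0 < 1 - a ^ 2 := by nlinarith
  unfold shockStrengthDeriv
  positivity

theorem hasDerivAt_shockStrength (ha : 0 < a) (ha1 : a < 1) (hk : k ∈ Ico 1 (1 / a)) :
    HasDerivAt (shockStrength a) (shockStrengthDeriv a k) k := by
  obtain ⟨h1, h2, h3⟩ := shock_parameter_pos ha ha1 hk
  have h4 : 0 < 1 - a ^ 2 * k ^ 2 := by nlinarith [mul_pos ha h3]
  have h5 : 0 < k ^ 2 - a ^ 2 := by nlinarith
  refine ((hasDerivAt_shockRapidity ha ha1 hk).add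
    ((hasDerivAt_shockCompression ha ha1 hk).const_mul (a / (1 + a ^ 2)))).congr_deriv ?_
  unfold shockStrengthDeriv
  field_simp
  ring

/-- Up to a common factor the rapidity contributes `1 + k ^ 2` and the compression term `2 * k`.
Their sum and difference are the squares of `k + 1` and `k - 1`. -/
theorem hasDerivAt_shockCross (ha : 0 < a) (ha1 : a < 1) (hk : k ∈ Ico 1 (1 / a)) :
    HasDerivAt (shockCross a) (((k - 1) / (k + 1)) ^ 2 * shockStrengthDeriv a k) k := by
  obtain ⟨h1, h2, h3⟩ := shock_parameter_pos ha ha1 hk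
  have h4 : 0 < 1 - a ^ 2 * k ^ 2 := by nlinarith [mul_pos ha h3]
  have h5 : 0 < k ^ 2 - a ^ 2 := by nlinarith
  refine ((hasDerivAt_shockRapidity ha ha1 hk).sub
    ((hasDerivAt_shockCompression ha ha1 hk).const_mul (a / (1 + a ^ 2)))).congr_deriv ?_
  unfold shockStrengthDeriv
  field_simp
  ring

/-- The numerator collapses to a multiple of `(k ^ 2 - 1) ^ 2`, from which the factor `(k + 1) ^ 2`
of the strength derivative splits off. -/
theorem hasDerivAt_shockEntropy (ha : 0 < a) (ha1 : a < 1) (hk : k ∈ Ico 1 (1 / a)) :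
    HasDerivAt (shockEntropy a)
      (a * (1 + a ^ 2) / (1 - a ^ 2) * ((k - 1) ^ 2 / k) * shockStrengthDeriv a k) k := by
  obtain ⟨h1, h2, h3⟩ := shock_parameter_pos ha ha1 hk
  have h4 : 0 < 1 - a ^ 2 * k ^ 2 := by nlinarith [mul_pos ha h3]
  have h5 : 0 < k ^ 2 - a ^ 2 := by nlinarith
  have h6 : 0 < 1 - a ^ 2 := by nlinarith
  refine (((hasDerivAt_shockCompression ha ha1 hk).const_mul ((1 - a ^ 2) / 2)).sub
    ((Real.hasDerivAt_log h3.ne').const_mul (1 + a ^ 2))).congr_deriv ?_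
  unfold shockStrengthDeriv
  field_simp
  ring

theorem monotoneOn_crossSlope : MonotoneOn (fun k : ℝ => ((k - 1) / (k + 1)) ^ 2) (Ici 1) := by
  intro x hx y hy hxy
  have hx : 1 ≤ x := hx
  have hy : 1 ≤ y := hy
  refine pow_le_pow_left₀ (div_nonneg (by linarith) (by linarith)) ?_ 2
  rw [div_le_div_iff₀ (by linarith) (by linarith)]
  nlinarith

theorem monotoneOn_entropySlope : MonotoneOn (fun k : ℝ => (k - 1) ^ 2 / k) (Ici 1) := by
  intro x hx y hy hxy
  have hx : 1 ≤ x := hx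
  have hy : 1 ≤ y := hy
  simp only
  rw [div_le_div_iff₀ (by linarith) (by linarith)]
  -- After cross-multiplication the difference of the two sides is exactly `(y - x) * (x * y - 1)`.
  nlinarith [mul_nonneg (sub_nonneg.2 hxy) (by nlinarith : 0 ≤ x * y - 1)]

/-- The strength blows up as `k` tends to `1 / a`, but the slope stays finite there. Its limiting
value is below 1, which makes the coupling of the two families contractive. -/
theorem exists_slope_shockCross (ha : 0 < a) (ha1 : a < 1) {k₁ k₂ k₃ : ℝ}
    (h₁ : k₁ ∈ Ico 1 (1 / a)) (h₂ : k₂ ∈ Ico 1 (1 / a)) (h₃ : k₃ ∈ Ico 1 (1 / a)) :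
    ∃ μ, 0 ≤ μ ∧ μ ≤ ((1 / a - 1) / (1 / a + 1)) ^ 2 ∧
      shockCross a k₁ + shockCross a k₂ - shockCross a k₃ ≤
        μ * (shockStrength a k₁ + shockStrength a k₂ - shockStrength a k₃) :=
  exists_slope_of_hasDerivAt (fun _ hk => hasDerivAt_shockStrength ha ha1 hk)
    (fun _ hk => hasDerivAt_shockCross ha ha1 hk)
    (fun _ hk => shockStrengthDeriv_nonneg ha ha1 hk)
    (monotoneOn_crossSlope.mono Ico_subset_Ici_self) (fun _ _ => sq_nonneg _)
    (fun _ hk => monotoneOn_crossSlope hk.1 (hk.1.trans hk.2.le) hk.2.le)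
    (shockStrength_one ha1 ha) (shockCross_one ha1 ha) h₁ h₂ h₃

theorem exists_slope_shockEntropy (ha : 0 < a) (ha1 : a < 1) {k₁ k₂ k₃ : ℝ}
    (h₁ : k₁ ∈ Ico 1 (1 / a)) (h₂ : k₂ ∈ Ico 1 (1 / a)) (h₃ : k₃ ∈ Ico 1 (1 / a)) :
    ∃ μ, 0 ≤ μ ∧ μ ≤ a * (1 + a ^ 2) / (1 - a ^ 2) * ((1 / a - 1) ^ 2 / (1 / a)) ∧
      shockEntropy a k₁ + shockEntropy a k₂ - shockEntropy a k₃ ≤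
        μ * (shockStrength a k₁ + shockStrength a k₂ - shockStrength a k₃) := by
  have hc : 0 ≤ a * (1 + a ^ 2) / (1 - a ^ 2) := by
    have : 0 < 1 - a ^ 2 := by nlinarith
    positivity
  exact exists_slope_of_hasDerivAt (fun _ hk => hasDerivAt_shockStrength ha ha1 hk)
    (fun _ hk => hasDerivAt_shockEntropy ha ha1 hk)
    (fun _ hk => shockStrengthDeriv_nonneg ha ha1 hk)
    (fun _ hx _ hy hxy => mul_le_mul_of_nonneg_left (monotoneOn_entropySlope hx.1 hy.1 hxy) hc)
    (fun k hk => mul_nonneg hc (div_nonneg (sq_nonneg _) (zero_le_one.trans hk.1)))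
    (fun _ hk => mul_le_mul_of_nonneg_left
      (monotoneOn_entropySlope hk.1 (hk.1.trans hk.2.le) hk.2.le) hc)
    (shockStrength_one ha1 ha) (shockEntropy_one ha1 ha) h₁ h₂ h₃

/-- Both the strength and the entropy jump of a shock are nonnegative; a shock of strength zero
has no entropy jump. -/
theorem shock_nonneg (ha : 0 < a) (ha1 : a < 1) (hk : k ∈ Ico 1 (1 / a)) :
    0 ≤ shockStrength a k ∧ 0 ≤ shockEntropy a k ∧
      (shockStrength a k = 0 → shockEntropy a k = 0) := by
  have h1 : (1 : ℝ) ∈ Ico 1 (1 / a) := ⟨le_rfl, hk.1.trans_lt hk.2⟩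
  have hc : 0 ≤ a * (1 + a ^ 2) / (1 - a ^ 2) := by
    have : 0 < 1 - a ^ 2 := by nlinarith
    positivity
  have hp : 0 ≤ shockStrength a k := shockStrength_one ha1 ha ▸
    le_of_hasDerivAt_nonneg (fun _ hk => hasDerivAt_shockStrength ha ha1 hk) h1 hk
      (fun x hx => shockStrengthDeriv_nonneg ha ha1 ⟨hx.1, hx.2.trans_lt hk.2⟩) hk.1
  -- On the interval from 1 to `k`: the slope vanishes at 1, so the lower bound is 0, while the
  -- upper bound is a multiple of the strength.
  have hb := increment_bounds_of_hasDerivAt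
    (fun _ hk => hasDerivAt_shockStrength ha ha1 hk)
    (fun _ hk => hasDerivAt_shockEntropy ha ha1 hk)
    (fun _ hk => shockStrengthDeriv_nonneg ha ha1 hk)
    (fun _ hx _ hy hxy => mul_le_mul_of_nonneg_left (monotoneOn_entropySlope hx.1 hy.1 hxy) hc)
    h1 hk hk.1
  rw [shockStrength_one ha1 ha, shockEntropy_one ha1 ha, sub_zero, sub_zero] at hb
  refine ⟨hp, by simpa using hb.1, fun h => ?_⟩
  rw [h] at hb
  simp only [mul_zero] at hb
  exact le_antisymm hb.2 hb.1

end ShockParametrization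

/-! ### Equation of state and jump conditions. -/

section Thermodynamics

variable {γ : ℝ} {A : ℝ → ℝ} {U L R : FluidState}

theorem soundSpeed_sq (h : 1 < γ) : soundSpeed γ ^ 2 = γ - 1 :=
  Real.sq_sqrt (by linarith)

theorem soundSpeed_pos (h : 1 < γ) : 0 < soundSpeed γ := Real.sqrt_pos.2 (by linarith)

theorem soundSpeed_lt_one (h : γ < 2) : soundSpeed γ < 1 := by
  rw [soundSpeed, Real.sqrt_lt' one_pos]
  linarith

theorem energyDensity_pos (hA : AdmissibleEOS A) (hU : U.Physical) : 0 < energyDensity γ A U :=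
  mul_pos hU.1 (mul_pos (hA.pos _ hU.2.2.2) (Real.rpow_pos_of_pos hU.1 _))

theorem log_energyDensity (hA : AdmissibleEOS A) (hU : U.Physical) :
    Real.log (energyDensity γ A U) = entropySigma A U + γ * Real.log U.n := by
  have h1 := (hA.pos _ hU.2.2.2).ne'
  have h2 := (Real.rpow_pos_of_pos hU.1 (γ - 1)).ne'
  rw [energyDensity, internalEnergy, Real.log_mul hU.1.ne' (mul_ne_zero h1 h2),
    Real.log_mul h1 h2, Real.log_rpow hU.1, entropySigma]
  ring

theorem pressure_eq (hγ : 1 < γ) (hU : U.Physical) :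
    pressure γ A U = soundSpeed γ ^ 2 * energyDensity γ A U := by
  have hd : HasDerivAt (fun m => internalEnergy γ A m U.S)
      (A U.S * ((γ - 1) * U.n ^ (γ - 1 - 1))) U.n :=
    (Real.hasDerivAt_rpow_const (Or.inl hU.1.ne')).const_mul (A U.S)
  rw [pressure, hd.deriv, soundSpeed_sq hγ, energyDensity, internalEnergy,
    Real.rpow_sub_one hU.1.ne' (γ - 1)]
  have := hU.1.ne'
  field_simp

/-- The momentum and energy jump conditions in the frame of the discontinuity, and the square of
the baryon jump condition. -/
theorem RankineHugoniot.equations {c : ℝ} (hγ : 1 < γ) (hL : L.Physical) (hR : R.Physical)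
    (h : RankineHugoniot γ A c L R) :
    L.n * (L.v - c) / √(1 - L.v ^ 2) = R.n * (R.v - c) / √(1 - R.v ^ 2) ∧
    energyDensity γ A L * ((L.v - c) * (1 - c * L.v) / (1 - L.v ^ 2)) =
      energyDensity γ A R * ((R.v - c) * (1 - c * R.v) / (1 - R.v ^ 2)) ∧
    energyDensity γ A L * ((1 + soundSpeed γ ^ 2) * ((L.v - c) ^ 2 / (1 - L.v ^ 2))
        + soundSpeed γ ^ 2 * (1 - c ^ 2)) =
      energyDensity γ A R * ((1 + soundSpeed γ ^ 2) * ((R.v - c) ^ 2 / (1 - R.v ^ 2))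
        + soundSpeed γ ^ 2 * (1 - c ^ 2)) := by
  have h0 := congrFun h 0
  have h1 := congrFun h 1
  have h2 := congrFun h 2
  simp only [conserved, flux, Pi.smul_apply, Pi.sub_apply, smul_eq_mul, Matrix.cons_val,
    pressure_eq hγ hL, pressure_eq hγ hR] at h0 h1 h2
  have hLv : (1 - L.v ^ 2) ≠ 0 := by nlinarith [hL.2.1, hL.2.2.1]
  have hRv : (1 - R.v ^ 2) ≠ 0 := by nlinarith [hR.2.1, hR.2.2.1]
  have id0 : ∀ x : ℝ, 1 - x ^ 2 ≠ 0 → x ^ 2 / (1 - x ^ 2) = 1 / (1 - x ^ 2) - 1 := by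
    intro x hx
    field_simp
    ring
  have hγ' : 1 + soundSpeed γ ^ 2 ≠ 0 := by positivity
  set a := soundSpeed γ
  set ρL := energyDensity γ A L
  set ρR := energyDensity γ A R
  refine ⟨?_, ?_, ?_⟩
  · linear_combination h0
  · have e : ∀ x : ℝ, 1 - x ^ 2 ≠ 0 → (x - c) * (1 - c * x) / (1 - x ^ 2) =
        x / (1 - x ^ 2) - c * (x ^ 2 / (1 - x ^ 2)) - c * (1 / (1 - x ^ 2))
          + c ^ 2 * (x / (1 - x ^ 2)) := by
      intro x hx
      field_simp
      ring
    rw [e _ hLv, e _ hRv]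
    apply mul_left_cancel₀ hγ'
    rw [id0 _ hLv, id0 _ hRv] at *
    -- A Lorentz boost to speed `c`: energy balance minus `c` times momentum balance, with the roles
    -- exchanged in the last equation.
    linear_combination h2 - c * h1
  · have e : ∀ x : ℝ, 1 - x ^ 2 ≠ 0 → (x - c) ^ 2 / (1 - x ^ 2) =
        x ^ 2 / (1 - x ^ 2) - 2 * c * (x / (1 - x ^ 2)) + c ^ 2 * (1 / (1 - x ^ 2)) := by
      intro x hx
      field_simp
      ring
    rw [e _ hLv, e _ hRv]
    rw [id0 _ hLv, id0 _ hRv] at *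
    linear_combination h1 - c * h2

end Thermodynamics

/-! ### Shocks in their rest frame. -/

section Shocks

/-- Relative velocity of a fluid of velocity `v` in a frame of velocity `c`. -/
def relVelocity (c v : ℝ) : ℝ := (v - c) / (1 - c * v)

variable {c v : ℝ}

theorem one_sub_mul_pos (hc : |c| < 1) (hv : |v| < 1) : 0 < 1 - c * v := by
  rw [abs_lt] at hc hv
  nlinarith

theorem abs_relVelocity_lt_one (hc : |c| < 1) (hv : |v| < 1) : |relVelocity c v| < 1 := by
  have h := one_sub_mul_pos hc hv
  rw [abs_lt] at *
  rw [relVelocity, lt_div_iff₀ h, div_lt_iff₀ h]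
  constructor <;> nlinarith

/-- Cleared of denominators, both sides read `b + c - b * c * v < v`, symmetric in `b` and `c`. With
`b` the sound speed, this turns the Lax condition into supersonic inflow in the shock frame. -/
theorem lt_relVelocity_iff {b : ℝ} (hc : |c| < 1) (hv : |v| < 1) (hb : |b| < 1) :
    b < relVelocity c v ↔ c < relVelocity b v := by
  rw [relVelocity, relVelocity, lt_div_iff₀ (one_sub_mul_pos hc hv),
    lt_div_iff₀ (one_sub_mul_pos hb hv)]
  constructor <;> intro <;> nlinarith

theorem relVelocity_lt_iff {b : ℝ} (hc : |c| < 1) (hv : |v| < 1) (hb : |b| < 1) :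
    relVelocity c v < b ↔ relVelocity b v < c := by
  rw [relVelocity, relVelocity, div_lt_iff₀ (one_sub_mul_pos hc hv),
    div_lt_iff₀ (one_sub_mul_pos hb hv)]
  constructor <;> intro <;> nlinarith

/-- Rapidities add under boosts, so the rapidity jump across a shock is the same in every frame. -/
theorem log_relVelocity (hc : |c| < 1) (hv : |v| < 1) :
    Real.log ((1 + relVelocity c v) / (1 - relVelocity c v)) =
      Real.log ((1 + v) / (1 - v)) + Real.log ((1 - c) / (1 + c)) := by
  have h := (one_sub_mul_pos hc hv).ne'
  have h' : 1 - v * c ≠ 0 := by rwa [mul_comm]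
  rw [abs_lt] at hc hv
  have h1 : 0 < 1 + v := by linarith
  have h2 : 0 < 1 - v := by linarith
  have h3 : 0 < 1 + c := by linarith
  have h4 : 0 < 1 - c := by linarith
  rw [← Real.log_mul (by positivity) (by positivity)]
  congr 1
  have e1 : 1 + relVelocity c v = (1 + v) * (1 - c) / (1 - c * v) := by
    rw [relVelocity]; field_simp; ring
  have e2 : 1 - relVelocity c v = (1 - v) * (1 + c) / (1 - c * v) := by
    rw [relVelocity]; field_simp; ring
  rw [e1, e2]
  field_simp

theorem one_sub_relVelocity_sq (hc : |c| < 1) (hv : |v| < 1) :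
    1 - relVelocity c v ^ 2 = (1 - v ^ 2) * (1 - c ^ 2) / (1 - c * v) ^ 2 := by
  have h := (one_sub_mul_pos hc hv).ne'
  have h' : 1 - v * c ≠ 0 := by rwa [mul_comm]
  rw [relVelocity]
  field_simp
  ring

/-- The velocities on both sides of a standing shock satisfy `w w' = a²`. -/
theorem mul_eq_sq_of_standing_shock {a w w' ρ ρ' : ℝ} (ha : 0 < a) (hρ : 0 < ρ) (hρ' : 0 < ρ')
    (hw : a < w) (hw1 : w < 1) (hw' : w' < a) (hw1' : -1 < w')
    (h1 : ρ * (w / (1 - w ^ 2)) = ρ' * (w' / (1 - w' ^ 2)))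
    (h2 : ρ * ((1 + a ^ 2) * (w ^ 2 / (1 - w ^ 2)) + a ^ 2) =
      ρ' * ((1 + a ^ 2) * (w' ^ 2 / (1 - w' ^ 2)) + a ^ 2)) :
    0 < w' ∧ w * w' = a ^ 2 := by
  have hw0 : 0 < w := ha.trans hw
  have p1 : 0 < 1 - w ^ 2 := by nlinarith
  have p2 : 0 < 1 - w' ^ 2 := by nlinarith
  have hpos : 0 < ρ' * (w' / (1 - w' ^ 2)) := h1 ▸ by positivity
  have hw'0 : 0 < w' := by
    by_contra hcon
    have : w' / (1 - w' ^ 2) ≤ 0 := div_nonpos_of_nonpos_of_nonneg (by linarith) p2.le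
    nlinarith
  refine ⟨hw'0, ?_⟩
  -- Momentum flux divided by energy flux is `x + a ^ 2 / x`, which agrees at distinct points only
  -- if their product is `a ^ 2`.
  have e : ∀ x : ℝ, 0 < x → 0 < 1 - x ^ 2 →
      (1 + a ^ 2) * (x ^ 2 / (1 - x ^ 2)) + a ^ 2 = x / (1 - x ^ 2) * (x + a ^ 2 / x) := by
    intro x hx hx'
    field_simp
    ring
  rw [e w hw0 p1, e w' hw'0 p2, ← mul_assoc, ← mul_assoc, h1] at h2
  have h3 := mul_left_cancel₀ hpos.ne' h2
  have h4 : (w - w') * (w * w' - a ^ 2) = 0 := by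
    field_simp at h3
    linear_combination h3
  rcases mul_eq_zero.1 h4 with h | h <;> linarith

variable {γ : ℝ} {A : ℝ → ℝ} {L R : FluidState}

theorem FluidState.Physical.abs_v_lt_one {U : FluidState} (hU : U.Physical) : |U.v| < 1 :=
  abs_lt.2 ⟨hU.2.1, hU.2.2.1⟩

/-- Parametrization of standing shocks by the ratio `k` of the upstream velocity to the sound
speed. -/
theorem exists_parameter_of_standing_shock {a w w' ρ ρ' n n' : ℝ} (ha : 0 < a) (ha1 : a < 1)
    (hρ : 0 < ρ) (hρ' : 0 < ρ') (hn : 0 < n)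
    (hw : a < w) (hw1 : w < 1) (hw' : w' < a) (hw1' : -1 < w')
    (h0 : n ^ 2 * (w ^ 2 / (1 - w ^ 2)) = n' ^ 2 * (w' ^ 2 / (1 - w' ^ 2)))
    (h1 : ρ * (w / (1 - w ^ 2)) = ρ' * (w' / (1 - w' ^ 2)))
    (h2 : ρ * ((1 + a ^ 2) * (w ^ 2 / (1 - w ^ 2)) + a ^ 2) =
      ρ' * ((1 + a ^ 2) * (w' ^ 2 / (1 - w' ^ 2)) + a ^ 2)) :
    ∃ k ∈ Ico 1 (1 / a),
      1 / 2 * Real.log ((1 + w) / (1 - w)) - 1 / 2 * Real.log ((1 + w') / (1 - w')) =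
        shockRapidity a k ∧
      Real.log ρ' = Real.log ρ + shockCompression a k ∧
      2 * Real.log n' = 2 * Real.log n + 2 * Real.log k + shockCompression a k := by
  obtain ⟨hw0, hww⟩ := mul_eq_sq_of_standing_shock ha hρ hρ' hw hw1 hw' hw1' h1 h2
  obtain ⟨k, rfl⟩ : ∃ k, w = a * k := ⟨w / a, by field_simp⟩
  have hk1 : 1 < k := by
    by_contra hcon
    nlinarith
  have hkm : k ∈ Ico 1 (1 / a) := ⟨hk1.le, by rw [lt_div_iff₀ ha]; linarith⟩
  obtain ⟨p1, p2, p3⟩ := shock_parameter_pos ha ha1 hkm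
  obtain rfl : w' = a / k := by
    rw [eq_div_iff p3.ne']
    apply mul_left_cancel₀ ha.ne'
    linear_combination hww
  have p4 : 0 < 1 - a ^ 2 * k ^ 2 := by nlinarith [mul_pos ha p3]
  have p5 : 0 < k ^ 2 - a ^ 2 := by nlinarith
  have p6 : 1 - (a / k) ^ 2 = (k ^ 2 - a ^ 2) / k ^ 2 := by field_simp
  have hrap : (1 + a / k) / (1 - a / k) = (k + a) / (k - a) := by field_simp
  rw [p6, mul_pow] at h0 h1
  refine ⟨k, hkm, by rw [hrap, shockRapidity], ?_, ?_⟩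
  · have hρ : ρ' = ρ * ((k ^ 2 - a ^ 2) / (1 - a ^ 2 * k ^ 2)) := by
      field_simp at h1 ⊢
      linear_combination -h1
    rw [hρ, Real.log_mul (by positivity) (div_pos p5 p4).ne', shockCompression]
  -- Working with squares avoids both the Lorentz square roots and the sign of `n'`.
  · have hn2 : n' ^ 2 = n ^ 2 * k ^ 2 * ((k ^ 2 - a ^ 2) / (1 - a ^ 2 * k ^ 2)) := by
      field_simp at h0 ⊢
      linear_combination -h0
    have h := congrArg Real.log hn2
    rw [Real.log_mul (by positivity) (div_pos p5 p4).ne', Real.log_mul (by positivity)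
      (by positivity), Real.log_pow, Real.log_pow, Real.log_pow] at h
    exact_mod_cast h

theorem lambda1_eq (U : FluidState) : lambda1 γ U = relVelocity (soundSpeed γ) U.v := by
  rw [lambda1, relVelocity, mul_comm]

/-- The changes of `r`, `s` and `Σ` across a 1-shock. -/
theorem IsShock.exists_parameter (hγ1 : 1 < γ) (hγ2 : γ < 2) (hA : AdmissibleEOS A)
    (hL : L.Physical) (hR : R.Physical) (h : IsShock γ A (lambda1 γ) L R) :
    ∃ k ∈ Ico 1 (1 / soundSpeed γ),
      invR γ A R - invR γ A L = -shockStrength (soundSpeed γ) k ∧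
      invS γ A R - invS γ A L = -shockCross (soundSpeed γ) k ∧
      entropySigma A R - entropySigma A L = shockEntropy (soundSpeed γ) k := by
  obtain ⟨c, hRH, hcR, hcL⟩ := h
  obtain ⟨h0, h1, h2⟩ := hRH.equations hγ1 hL hR
  have ha := soundSpeed_pos hγ1
  have ha1 := soundSpeed_lt_one hγ2
  have hsq := soundSpeed_sq hγ1
  have hρL : 0 < energyDensity γ A L := energyDensity_pos hA hL
  have hρR : 0 < energyDensity γ A R := energyDensity_pos hA hR
  have hlL := log_energyDensity (γ := γ) hA hL
  have hlR := log_energyDensity (γ := γ) hA hR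
  rw [lambda1_eq] at hcR hcL
  have hvL := hL.abs_v_lt_one
  have hvR := hR.abs_v_lt_one
  set a := soundSpeed γ with ha_def
  set ρL := energyDensity γ A L
  set ρR := energyDensity γ A R
  have haa : |a| < 1 := by rwa [abs_of_pos ha]
  -- The Lax condition traps `c` between characteristic speeds, which are subluminal.
  have hc : |c| < 1 := abs_lt.2
    ⟨(abs_lt.1 (abs_relVelocity_lt_one haa hvR)).1.trans hcR,
      hcL.trans (abs_lt.1 (abs_relVelocity_lt_one haa hvL)).2⟩
  have hc2 : 0 < 1 - c ^ 2 := by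
    have := (sq_lt_one_iff_abs_lt_one c).2 hc
    linarith
  have one_sub_sq : ∀ v : ℝ, |v| < 1 → 0 < 1 - v ^ 2 := fun v hv => by
    have := (sq_lt_one_iff_abs_lt_one v).2 hv
    linarith
  have wL := (lt_relVelocity_iff hc hvL haa).2 hcL
  have wR := (relVelocity_lt_iff hc hvR haa).2 hcR
  have awL := abs_relVelocity_lt_one hc hvL
  have awR := abs_relVelocity_lt_one hc hvR
  have lwL := log_relVelocity hc hvL
  have lwR := log_relVelocity hc hvR
  have t1 : ∀ v : ℝ, |v| < 1 → (v - c) * (1 - c * v) / (1 - v ^ 2) =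
      (1 - c ^ 2) * (relVelocity c v / (1 - relVelocity c v ^ 2)) := by
    intro v hv
    have h := one_sub_mul_pos hc hv
    have h' : 0 < 1 - v * c := by rwa [mul_comm]
    have := one_sub_sq v hv
    rw [one_sub_relVelocity_sq hc hv, relVelocity]
    field_simp
  have t2 : ∀ v : ℝ, |v| < 1 → (v - c) ^ 2 / (1 - v ^ 2) =
      (1 - c ^ 2) * (relVelocity c v ^ 2 / (1 - relVelocity c v ^ 2)) := by
    intro v hv
    have h := one_sub_mul_pos hc hv
    have h' : 0 < 1 - v * c := by rwa [mul_comm]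
    have := one_sub_sq v hv
    rw [one_sub_relVelocity_sq hc hv, relVelocity]
    field_simp
  have h0' : L.n ^ 2 * (relVelocity c L.v ^ 2 / (1 - relVelocity c L.v ^ 2)) =
      R.n ^ 2 * (relVelocity c R.v ^ 2 / (1 - relVelocity c R.v ^ 2)) := by
    have h := congrArg (· ^ 2) h0
    simp only [div_pow, mul_pow, Real.sq_sqrt (one_sub_sq _ hvL).le,
      Real.sq_sqrt (one_sub_sq _ hvR).le] at h
    rw [mul_div_assoc, mul_div_assoc, t2 _ hvL, t2 _ hvR] at h
    apply mul_left_cancel₀ hc2.ne'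
    linear_combination h
  rw [t1 _ hvL, t1 _ hvR] at h1
  rw [t2 _ hvL, t2 _ hvR] at h2
  have h1' : ρL * (relVelocity c L.v / (1 - relVelocity c L.v ^ 2)) =
      ρR * (relVelocity c R.v / (1 - relVelocity c R.v ^ 2)) := by
    apply mul_left_cancel₀ hc2.ne'
    linear_combination h1
  have h2' : ρL * ((1 + a ^ 2) * (relVelocity c L.v ^ 2 / (1 - relVelocity c L.v ^ 2)) + a ^ 2) =
      ρR * ((1 + a ^ 2) * (relVelocity c R.v ^ 2 / (1 - relVelocity c R.v ^ 2)) + a ^ 2) := by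
    apply mul_left_cancel₀ hc2.ne'
    linear_combination h2
  obtain ⟨k, hk, hrap, hP, hN⟩ := exists_parameter_of_standing_shock ha ha1 hρL hρR hL.1 wL
    (abs_lt.1 awL).2 wR (abs_lt.1 awR).1 h0' h1' h2'
  refine ⟨k, hk, ?_, ?_, ?_⟩
  · simp only [invR, ← ha_def, shockStrength]
    linear_combination -hrap - (1 / 2) * lwR + (1 / 2) * lwL - a / (1 + a ^ 2) * hP
  · simp only [invS, ← ha_def, shockCross]
    linear_combination -hrap - (1 / 2) * lwR + (1 / 2) * lwL + a / (1 + a ^ 2) * hP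
  -- Here Σ is recovered as log ρ - γ log n.
  · have hg : γ = 1 + a ^ 2 := by linarith
    rw [shockEntropy]
    rw [hg] at hlL hlR
    linear_combination hP - hlR + hlL - (1 + a ^ 2) / 2 * hN

end Shocks

/-! ### Mirror symmetry exchanging the 1- and 3-families. -/

section Reflection

/-- Mirror image of a state under `x ↦ -x`. -/
def FluidState.reflect (U : FluidState) : FluidState := ⟨U.n, -U.v, U.S⟩

variable {γ : ℝ} {A : ℝ → ℝ} {U L R : FluidState}

theorem FluidState.Physical.reflect (hU : U.Physical) : U.reflect.Physical :=
  ⟨hU.1, neg_lt_neg hU.2.2.1, neg_lt.1 hU.2.1, hU.2.2.2⟩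

theorem log_reflect (v : ℝ) : Real.log ((1 + -v) / (1 - -v)) = -Real.log ((1 + v) / (1 - v)) := by
  rw [← Real.log_inv, inv_div, sub_neg_eq_add, ← sub_eq_add_neg]

theorem invR_reflect : invR γ A U.reflect = -invS γ A U := by
  simp only [invR, invS, FluidState.reflect, energyDensity, log_reflect]
  ring

theorem invS_reflect : invS γ A U.reflect = -invR γ A U := by
  simp only [invR, invS, FluidState.reflect, energyDensity, log_reflect]
  ring

theorem lambda1_reflect : lambda1 γ U.reflect = -lambda3 γ U := by
  simp only [lambda1, lambda3, FluidState.reflect]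
  rw [← neg_div, neg_mul, sub_neg_eq_add]
  ring

/-- Baryon density, energy density and momentum flux are even under `v ↦ -v`, the other components
odd. Each jump condition thus survives up to sign once the sides are swapped and the speed is
negated. -/
theorem IsShock.reflect (h : IsShock γ A (lambda3 γ) L R) :
    IsShock γ A (lambda1 γ) R.reflect L.reflect := by
  obtain ⟨c, h, h1, h2⟩ := h
  refine ⟨-c, ?_, by simpa [lambda1_reflect] using h2, by simpa [lambda1_reflect] using h1⟩
  have h0 := congrFun h 0
  have h1 := congrFun h 1
  have h2 := congrFun h 2
  simp only [conserved, flux, Pi.smul_apply, Pi.sub_apply, smul_eq_mul, Matrix.cons_val]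
    at h0 h1 h2
  funext i
  fin_cases i <;>
  simp only [conserved, flux, Pi.smul_apply, Pi.sub_apply, smul_eq_mul, Matrix.cons_val,
    FluidState.reflect, energyDensity, pressure, neg_sq, Fin.zero_eta, Fin.mk_one,
    Fin.reduceFinMk] at h0 h1 h2 ⊢
  · linear_combination h0
  · linear_combination -h1
  · linear_combination h2

end Reflection

/-! ### Invariants along rarefaction curves, with `b = a` for the first family and `b = -a` for the
third. -/

section Rarefaction

/-- Along a characteristic curve for the eigenvalue `(v - b) / (1 - v b)`, `b² = γ - 1`: the
linear relations between the derivatives of `n`, `v` and `ρ`. -/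
theorem characteristic_relations {b n v ρ n' v' ρ' q : ℝ}
    (hbv : 1 - v * b ≠ 0) (hbv' : 1 + v * b ≠ 0) (hq : q ≠ 0) (hv : 1 - v ^ 2 ≠ 0)
    (hqv : q ^ 2 * (1 - v ^ 2) = 1)
    (h0 : (n' * v + n * v') * q + n * v * (q ^ 3 * (v * v')) =
      (v - b) / (1 - v * b) * (n' * q + n * (q ^ 3 * (v * v'))))
    (h2 : (1 + b ^ 2) *
        (ρ' * (v / (1 - v ^ 2)) + ρ * ((1 + v ^ 2) * v' / (1 - v ^ 2) ^ 2)) =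
      (v - b) / (1 - v * b) * ((1 + b ^ 2) *
        (ρ' * (v ^ 2 / (1 - v ^ 2)) + ρ * (2 * v * v' / (1 - v ^ 2) ^ 2)) + ρ')) :
    n' * (b * (1 - v ^ 2)) + n * v' = 0 ∧
      ρ' * (b * (1 - v ^ 2)) + (1 + b ^ 2) * ρ * v' = 0 := by
  have hbv'' : 1 - b * v ≠ 0 := by rwa [mul_comm]
  constructor
  · have e : q ^ 2 = 1 / (1 - v ^ 2) := by rw [eq_div_iff hv, hqv]
    have h0' : n' * v + n * v' + n * v * (q ^ 2 * (v * v')) =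
      (v - b) / (1 - v * b) * (n' + n * (q ^ 2 * (v * v'))) := by
      apply mul_left_cancel₀ hq
      linear_combination h0
    rw [e] at h0'
    field_simp at h0'
    apply mul_left_cancel₀ hv
    linear_combination h0'
  · field_simp at h2
    apply mul_left_cancel₀ (mul_ne_zero hbv' hv)
    linear_combination h2

variable {γ : ℝ} {A : ℝ → ℝ}

theorem hasDerivWithinAt_lorentzFactor {v : ℝ → ℝ} {v' t : ℝ} {s : Set ℝ}
    (hv : HasDerivWithinAt v v' s t) (h : 0 < 1 - v t ^ 2) :
    HasDerivWithinAt (fun τ => (√(1 - v τ ^ 2))⁻¹) ((√(1 - v t ^ 2))⁻¹ ^ 3 * (v t * v')) s t := by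
  have hs : √(1 - v t ^ 2) ≠ 0 := (Real.sqrt_pos.2 h).ne'
  refine ((((hv.pow 2).const_sub 1).sqrt h.ne').inv hs).congr_deriv ?_
  simp only [Pi.pow_apply]
  field_simp
  norm_num
  ring

/-- Derivatives of the conserved quantities and fluxes along a curve of physical states satisfying
the characteristic equation, and the resulting relations. -/
theorem characteristic_relations_of_derivWithin {b t : ℝ} {n v S : ℝ → ℝ} {n' v' ρ' : ℝ}
    (hγ : 1 < γ) (hb : b ^ 2 = soundSpeed γ ^ 2) (hb1 : |b| < 1)
    (ht : t ∈ Icc (0 : ℝ) 1)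
    (hphys : ∀ t ∈ Icc (0 : ℝ) 1, (⟨n t, v t, S t⟩ : FluidState).Physical)
    (hn : HasDerivWithinAt n n' (Icc 0 1) t) (hv : HasDerivWithinAt v v' (Icc 0 1) t)
    (hρ : HasDerivWithinAt (fun τ => energyDensity γ A ⟨n τ, v τ, S τ⟩) ρ' (Icc 0 1) t)
    (h : derivWithin (fun τ => flux γ A ⟨n τ, v τ, S τ⟩) (Icc 0 1) t =
      ((v t - b) / (1 - v t * b)) •
        derivWithin (fun τ => conserved γ A ⟨n τ, v τ, S τ⟩) (Icc 0 1) t) :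
    n' * (b * (1 - v t ^ 2)) + n t * v' = 0 ∧
      ρ' * (b * (1 - v t ^ 2)) +
        (1 + b ^ 2) * energyDensity γ A ⟨n t, v t, S t⟩ * v' = 0 := by
  have hvt : |v t| < 1 := (hphys t ht).abs_v_lt_one
  have hv2 : 0 < 1 - v t ^ 2 := by
    have := (sq_lt_one_iff_abs_lt_one (v t)).2 hvt
    linarith
  have hq := hasDerivWithinAt_lorentzFactor hv hv2
  have hV1 : HasDerivWithinAt (fun τ => v τ / (1 - v τ ^ 2))
      ((1 + v t ^ 2) * v' / (1 - v t ^ 2) ^ 2) (Icc 0 1) t := by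
    refine (hv.div ((hv.pow 2).const_sub 1) hv2.ne').congr_deriv ?_
    simp only [Pi.pow_apply]
    norm_num
    ring
  have hV2 : HasDerivWithinAt (fun τ => v τ ^ 2 / (1 - v τ ^ 2))
      (2 * v t * v' / (1 - v t ^ 2) ^ 2) (Icc 0 1) t := by
    refine ((hv.pow 2).div ((hv.pow 2).const_sub 1) hv2.ne').congr_deriv ?_
    simp only [Pi.pow_apply]
    norm_num
    ring
  set ρ : ℝ → ℝ := fun τ => energyDensity γ A ⟨n τ, v τ, S τ⟩ with hρdef
  have hF : HasDerivWithinAt (fun τ => flux γ A ⟨n τ, v τ, S τ⟩)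
      ![(n' * v t + n t * v') * (√(1 - v t ^ 2))⁻¹ +
          n t * v t * ((√(1 - v t ^ 2))⁻¹ ^ 3 * (v t * v')),
        (1 + b ^ 2) * (ρ' * (v t ^ 2 / (1 - v t ^ 2)) +
          ρ t * (2 * v t * v' / (1 - v t ^ 2) ^ 2)) + b ^ 2 * ρ',
        (1 + b ^ 2) * (ρ' * (v t / (1 - v t ^ 2)) +
          ρ t * ((1 + v t ^ 2) * v' / (1 - v t ^ 2) ^ 2))] (Icc 0 1) t := by
    have e : ∀ τ ∈ Icc (0 : ℝ) 1, flux γ A ⟨n τ, v τ, S τ⟩ =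
        ![n τ * v τ * (√(1 - v τ ^ 2))⁻¹,
          (1 + b ^ 2) * (ρ τ * (v τ ^ 2 / (1 - v τ ^ 2))) + b ^ 2 * ρ τ,
          (1 + b ^ 2) * (ρ τ * (v τ / (1 - v τ ^ 2)))] := by
      intro τ hτ
      rw [flux, pressure_eq hγ (hphys τ hτ), ← hb]
      simp only [hρdef, div_eq_mul_inv]
      congr 1
      congr 1
      · ring
      congr 1
      ring
    refine HasDerivWithinAt.congr ?_ e (e t ht)
    rw [hasDerivWithinAt_pi]
    intro i
    fin_cases i
    · exact (hn.mul hv).mul hq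
    · exact ((hρ.mul hV2).const_mul _).add (hρ.const_mul _)
    · exact (hρ.mul hV1).const_mul _
  have hU : HasDerivWithinAt (fun τ => conserved γ A ⟨n τ, v τ, S τ⟩)
      ![n' * (√(1 - v t ^ 2))⁻¹ + n t * ((√(1 - v t ^ 2))⁻¹ ^ 3 * (v t * v')),
        (1 + b ^ 2) * (ρ' * (v t / (1 - v t ^ 2)) +
          ρ t * ((1 + v t ^ 2) * v' / (1 - v t ^ 2) ^ 2)),
        (1 + b ^ 2) * (ρ' * (v t ^ 2 / (1 - v t ^ 2)) +
          ρ t * (2 * v t * v' / (1 - v t ^ 2) ^ 2)) + ρ'] (Icc 0 1) t := by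
    have e : ∀ τ ∈ Icc (0 : ℝ) 1, conserved γ A ⟨n τ, v τ, S τ⟩ =
        ![n τ * (√(1 - v τ ^ 2))⁻¹,
          (1 + b ^ 2) * (ρ τ * (v τ / (1 - v τ ^ 2))),
          (1 + b ^ 2) * (ρ τ * (v τ ^ 2 / (1 - v τ ^ 2))) + ρ τ] := by
      intro τ hτ
      rw [conserved, pressure_eq hγ (hphys τ hτ), ← hb]
      simp only [hρdef, div_eq_mul_inv]
      congr 1
      congr 1
      · ring
      congr 1
      ring
    refine HasDerivWithinAt.congr ?_ e (e t ht)
    rw [hasDerivWithinAt_pi]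
    intro i
    fin_cases i
    · exact hn.mul hq
    · exact (hρ.mul hV1).const_mul _
    · exact ((hρ.mul hV2).const_mul _).add hρ
  have hud := uniqueDiffOn_Icc (zero_lt_one (α := ℝ)) t ht
  rw [hF.derivWithin hud, hU.derivWithin hud] at h
  have h0 := congrFun h 0
  have h2 := congrFun h 2
  simp only [Pi.smul_apply, smul_eq_mul, Matrix.cons_val] at h0 h2
  have hvb := one_sub_mul_pos hvt hb1
  have hvb' := one_sub_mul_pos hvt (by rwa [abs_neg] : |(-b)| < 1)
  rw [mul_neg, sub_neg_eq_add] at hvb'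
  refine characteristic_relations hvb.ne' hvb'.ne'
    (inv_ne_zero (Real.sqrt_pos.2 hv2).ne') hv2.ne' ?_ h0 h2
  rw [inv_pow, Real.sq_sqrt hv2.le, inv_mul_cancel₀ hv2.ne']

/-- Rarefaction waves preserve `Σ` and one Riemann invariant. -/
theorem IsRarefaction.invariants {b : ℝ} {lam : FluidState → ℝ} {L R : FluidState}
    (hγ : 1 < γ) (hA : AdmissibleEOS A) (hb : b ^ 2 = soundSpeed γ ^ 2) (hb0 : b ≠ 0)
    (hb1 : |b| < 1) (hlam : ∀ U : FluidState, lam U = (U.v - b) / (1 - U.v * b))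
    (h : IsRarefaction γ A lam L R) :
    entropySigma A R = entropySigma A L ∧
      1 / 2 * Real.log ((1 + R.v) / (1 - R.v)) + b / (1 + b ^ 2) * Real.log (energyDensity γ A R) =
      1 / 2 * Real.log ((1 + L.v) / (1 - L.v)) + b / (1 + b ^ 2) * Real.log (energyDensity γ A L)
      := by
  obtain ⟨-, n, v, S, hn, hv, hS, rfl, rfl, hc⟩ := h
  have hphys : ∀ t ∈ Icc (0 : ℝ) 1, (⟨n t, v t, S t⟩ : FluidState).Physical :=
    fun t ht => (hc t ht).1
  have hγb : γ = 1 + b ^ 2 := by rw [hb, soundSpeed_sq hγ]; ring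
  set ρ : ℝ → ℝ := fun τ => energyDensity γ A ⟨n τ, v τ, S τ⟩ with hρdef
  have hρ : DifferentiableOn ℝ ρ (Icc 0 1) := by
    intro t ht
    have hAd : DifferentiableAt ℝ A (S t) :=
      ((hA.contDiffOn.differentiableOn one_ne_zero) _ (hphys t ht).2.2.2).differentiableAt
        (Ioi_mem_nhds (hphys t ht).2.2.2)
    exact (hn t ht).mul ((hAd.comp_differentiableWithinAt t (hS t ht)).mul
      ((hn t ht).rpow_const (Or.inl (hphys t ht).1.ne')))
  have hρpos : ∀ t ∈ Icc (0 : ℝ) 1, 0 < ρ t := fun t ht => energyDensity_pos hA (hphys t ht)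
  have hrel : ∀ t ∈ Icc (0 : ℝ) 1,
      derivWithin n (Icc 0 1) t * (b * (1 - v t ^ 2)) + n t * derivWithin v (Icc 0 1) t = 0 ∧
      derivWithin ρ (Icc 0 1) t * (b * (1 - v t ^ 2)) +
        (1 + b ^ 2) * ρ t * derivWithin v (Icc 0 1) t = 0 := fun t ht =>
    characteristic_relations_of_derivWithin hγ hb hb1 ht hphys (hn t ht).hasDerivWithinAt
      (hv t ht).hasDerivWithinAt (hρ t ht).hasDerivWithinAt (by rw [(hc t ht).2, hlam])
  have const : ∀ f : ℝ → ℝ, (∀ t ∈ Icc (0 : ℝ) 1, HasDerivWithinAt f 0 (Icc 0 1) t) →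
      f 1 = f 0 := fun f hf =>
    constant_of_derivWithin_zero (fun t ht => (hf t ht).differentiableWithinAt)
      (fun t ht => (hf t (Ico_subset_Icc_self ht)).derivWithin
        (uniqueDiffOn_Icc zero_lt_one t (Ico_subset_Icc_self ht))) 1 (right_mem_Icc.2 zero_le_one)
  have hv2 : ∀ t ∈ Icc (0 : ℝ) 1, 0 < 1 - v t ^ 2 := fun t ht => by
    have := (sq_lt_one_iff_abs_lt_one (v t)).2 (hphys t ht).abs_v_lt_one
    linarith
  constructor
  -- This function is Σ along the curve; eliminating the derivative of `v` from the two relations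
  -- shows that it is constant.
  · have := const (fun t => Real.log (ρ t) - γ * Real.log (n t)) fun t ht => by
      obtain ⟨r1, r2⟩ := hrel t ht
      have hn0 := (hphys t ht).1.ne'
      have hρ0 := (hρpos t ht).ne'
      simp only at hn0
      refine (((hρ t ht).hasDerivWithinAt.log hρ0).sub
        (((hn t ht).hasDerivWithinAt.log hn0).const_mul γ)).congr_deriv ?_
      rw [hγb]
      field_simp
      apply mul_left_cancel₀ (mul_ne_zero hb0 (hv2 t ht).ne')
      linear_combination n t * r2 - (1 + b ^ 2) * ρ t * r1
    simp only [hρdef, log_energyDensity hA (hphys 0 (left_mem_Icc.2 zero_le_one)),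
      log_energyDensity hA (hphys 1 (right_mem_Icc.2 zero_le_one))] at this
    linarith
  -- The function is s for `b = a` and r for `b = -a`.
  · refine const (fun t => 1 / 2 * Real.log ((1 + v t) / (1 - v t)) +
      b / (1 + b ^ 2) * Real.log (ρ t)) fun t ht => ?_
    obtain ⟨-, r2⟩ := hrel t ht
    have hρ0 := (hρpos t ht).ne'
    have hp : 0 < 1 + v t := by linarith [(hphys t ht).2.1]
    have hm : 0 < 1 - v t := by linarith [(hphys t ht).2.2.1]
    have hd := (hv t ht).hasDerivWithinAt
    refine (((((hd.const_add 1).div (hd.const_sub 1) hm.ne').log (div_pos hp hm).ne').const_mul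
      (1 / 2)).add (((hρ t ht).hasDerivWithinAt.log hρ0).const_mul (b / (1 + b ^ 2)))).congr_deriv ?_
    simp only [Pi.div_apply]
    field_simp
    linear_combination 2 * r2

/-- The velocity increases across a rarefaction wave. -/
theorem IsRarefaction.v_lt {b : ℝ} {lam : FluidState → ℝ} {L R : FluidState}
    (hL : L.Physical) (hR : R.Physical) (hb1 : |b| < 1)
    (hlam : ∀ U : FluidState, lam U = (U.v - b) / (1 - U.v * b))
    (h : IsRarefaction γ A lam L R) : L.v < R.v := by
  have h1 := h.1
  have p1 := one_sub_mul_pos hL.abs_v_lt_one hb1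
  have p2 := one_sub_mul_pos hR.abs_v_lt_one hb1
  have p3 : 0 < 1 - b ^ 2 := by
    have := (sq_lt_one_iff_abs_lt_one b).2 hb1
    linarith
  -- Cross-multiplied, the inequality becomes `0 < (R.v - L.v) * (1 - b ^ 2)`.
  rw [hlam, hlam, div_lt_div_iff₀ p1 p2] at h1
  nlinarith

theorem log_rapidity_lt {v w : ℝ} (hv : -1 < v) (hw : w < 1) (h : v < w) :
    Real.log ((1 + v) / (1 - v)) < Real.log ((1 + w) / (1 - w)) := by
  apply Real.log_lt_log (div_pos (by linarith) (by linarith))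
  rw [div_lt_div_iff₀ (by linarith) (by linarith)]
  nlinarith

end Rarefaction

/-! ### Uniform description of all waves by shock parameters. -/

section Waves

variable {γ : ℝ} {A : ℝ → ℝ} {L R : FluidState}

/-- The changes `ε` of the Riemann invariant of its own family, `d` of the other one, and `σ` of
`Σ` across a wave whose shock part has parameter `k` (`k = 1` if there is no shock). -/
structure WaveJump (a k ε d σ : ℝ) : Prop where
  mem : k ∈ Ico 1 (1 / a)
  strength_eq : (if ε ≤ 0 then -ε else 0) = shockStrength a k
  cross_eq : d = -shockCross a k
  entropy_eq : σ = shockEntropy a k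

theorem WaveJump.of_shock {a k ε d σ : ℝ} (ha : 0 < a) (ha1 : a < 1) (hk : k ∈ Ico 1 (1 / a))
    (hε : ε = -shockStrength a k) (hd : d = -shockCross a k) (hσ : σ = shockEntropy a k) :
    WaveJump a k ε d σ :=
  ⟨hk, by rw [if_pos (by linarith [(shock_nonneg ha ha1 hk).1]), hε, neg_neg], hd, hσ⟩

theorem WaveJump.of_rarefaction {a ε : ℝ} (ha : 0 < a) (ha1 : a < 1) (hε : 0 ≤ ε) :
    WaveJump a 1 ε 0 0 := by
  refine ⟨⟨le_rfl, by rwa [lt_div_iff₀ ha, one_mul]⟩, ?_, ?_, ?_⟩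
  · rw [shockStrength_one ha1 ha]
    split_ifs <;> linarith
  · rw [shockCross_one ha1 ha, neg_zero]
  · rw [shockEntropy_one ha1 ha]

theorem exists_waveJump_one (hγ1 : 1 < γ) (hγ2 : γ < 2) (hA : AdmissibleEOS A)
    (hL : L.Physical) (hR : R.Physical) (h : IsNonlinearWave γ A (lambda1 γ) L R) :
    ∃ k, WaveJump (soundSpeed γ) k (invR γ A R - invR γ A L) (invS γ A R - invS γ A L)
      (entropySigma A R - entropySigma A L) := by
  have ha := soundSpeed_pos hγ1
  have ha1 := soundSpeed_lt_one hγ2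
  rcases h with rfl | h | h
  · simp only [sub_self]
    exact ⟨1, .of_rarefaction ha ha1 le_rfl⟩
  · have haa : |soundSpeed γ| < 1 := by rwa [abs_of_pos ha]
    obtain ⟨h1, h2⟩ := h.invariants hγ1 hA rfl ha.ne' haa fun _ => rfl
    have hv := log_rapidity_lt hL.2.1 hR.2.2.1 (h.v_lt hL hR haa fun _ => rfl)
    have h3 : invS γ A R = invS γ A L := h2
    rw [h1, h3, sub_self, sub_self]
    refine ⟨1, .of_rarefaction ha ha1 ?_⟩
    -- Since r + s = ln((1+v)/(1-v)) and s is constant, r grows with `v`.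
    simp only [invR]
    linarith
  · obtain ⟨k, hk, h1, h2, h3⟩ := h.exists_parameter hγ1 hγ2 hA hL hR
    exact ⟨k, .of_shock ha ha1 hk h1 h2 h3⟩

/-- The state ahead of a 3-shock is the right one, hence the reversed difference of Σ. Shocks reduce
to the first family by reflection. -/
theorem exists_waveJump_three (hγ1 : 1 < γ) (hγ2 : γ < 2) (hA : AdmissibleEOS A)
    (hL : L.Physical) (hR : R.Physical) (h : IsNonlinearWave γ A (lambda3 γ) L R) :
    ∃ k, WaveJump (soundSpeed γ) k (invS γ A R - invS γ A L) (invR γ A R - invR γ A L)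
      (entropySigma A L - entropySigma A R) := by
  have ha := soundSpeed_pos hγ1
  have ha1 := soundSpeed_lt_one hγ2
  rcases h with rfl | h | h
  · simp only [sub_self]
    exact ⟨1, .of_rarefaction ha ha1 le_rfl⟩
  · have haa : |-soundSpeed γ| < 1 := by rwa [abs_neg, abs_of_pos ha]
    have hlam : ∀ U : FluidState,
        lambda3 γ U = (U.v - -soundSpeed γ) / (1 - U.v * -soundSpeed γ) := fun U => by
      rw [lambda3, sub_neg_eq_add, mul_neg, sub_neg_eq_add]
    obtain ⟨h1, h2⟩ := h.invariants hγ1 hA (neg_sq _) (neg_ne_zero.2 ha.ne') haa hlam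
    have hv := log_rapidity_lt hL.2.1 hR.2.2.1 (h.v_lt hL hR haa hlam)
    rw [neg_sq, neg_div, neg_mul, neg_mul, ← sub_eq_add_neg, ← sub_eq_add_neg] at h2
    have h3 : invR γ A R = invR γ A L := h2
    rw [h1, h3, sub_self, sub_self]
    refine ⟨1, .of_rarefaction ha ha1 ?_⟩
    simp only [invS, invR] at h3 ⊢
    linarith
  · obtain ⟨k, hk, h1, h2, h3⟩ := h.reflect.exists_parameter hγ1 hγ2 hA hR.reflect hL.reflect
    rw [invR_reflect, invR_reflect] at h1
    rw [invS_reflect, invS_reflect] at h2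
    exact ⟨k, .of_shock ha ha1 hk (by linarith) (by linarith) h3⟩

theorem WaveJump.entropy_nonneg {a k ε d σ : ℝ} (ha : 0 < a) (ha1 : a < 1)
    (h : WaveJump a k ε d σ) : 0 ≤ σ := by
  rw [h.entropy_eq]
  exact (shock_nonneg ha ha1 h.mem).2.1

/-- Removes the case distinctions in `deltaAlpha` and `deltaBeta`: Σ never decreases towards the
state behind the wave, and zero strength means zero jump. -/
theorem WaveJump.ite_entropy {a k ε d σ : ℝ} (ha : 0 < a) (ha1 : a < 1)
    (h : WaveJump a k ε d σ) :
    (if 0 < (if ε ≤ 0 then -ε else 0) then |σ| else 0) = shockEntropy a k := by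
  have hs := shock_nonneg ha ha1 h.mem
  rw [abs_of_nonneg (h.entropy_nonneg ha ha1), h.strength_eq, h.entropy_eq]
  split_ifs with hc
  · rfl
  · exact (hs.2.2 (le_antisymm (not_lt.1 hc) hs.1)).symm

/-- The Riemann invariants do not change across an entropy wave. -/
theorem IsEntropyWave.invariants (hγ : 1 < γ) (hL : L.Physical) (hR : R.Physical)
    (h : IsEntropyWave γ A L R) : invR γ A L = invR γ A R ∧ invS γ A L = invS γ A R := by
  obtain ⟨hv, hRH⟩ := h
  -- In the frame of the fluid the momentum balance is continuity of pressure, so ρ is continuous.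
  have h2 := (hRH.equations hγ hL hR).2.2
  have hv2 : 0 < 1 - L.v ^ 2 := by
    have := (sq_lt_one_iff_abs_lt_one L.v).2 hL.abs_v_lt_one
    linarith
  have ha2 : soundSpeed γ ^ 2 * (1 - L.v ^ 2) ≠ 0 :=
    mul_ne_zero (pow_ne_zero _ (soundSpeed_pos hγ).ne') hv2.ne'
  simp only [← hv, sub_self, ne_eq, OfNat.ofNat_ne_zero, not_false_eq_true, zero_pow, zero_div,
    mul_zero, zero_add] at h2
  have hρ : energyDensity γ A L = energyDensity γ A R := mul_right_cancel₀ ha2 h2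
  simp only [invR, invS, hv, hρ, and_self]

/-- All quantities of the solution of a Riemann problem in terms of the shock parameters. -/
theorem RiemannSolution.exists_parameters (hγ1 : 1 < γ) (hγ2 : γ < 2) (hA : AdmissibleEOS A)
    (hL : L.Physical) (hR : R.Physical) (w : RiemannSolution γ A L R) :
    ∃ k ∈ Ico 1 (1 / soundSpeed γ), ∃ l ∈ Ico 1 (1 / soundSpeed γ),
      w.alpha = shockStrength (soundSpeed γ) k ∧ w.beta = shockStrength (soundSpeed γ) l ∧
      w.deltaAlpha = shockEntropy (soundSpeed γ) k ∧
      w.deltaBeta = shockEntropy (soundSpeed γ) l ∧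
      invR γ A R - invR γ A L = w.eps1 - shockCross (soundSpeed γ) l ∧
      invS γ A R - invS γ A L = w.eps3 - shockCross (soundSpeed γ) k ∧
      entropySigma A R - entropySigma A L = shockEntropy (soundSpeed γ) k + w.delta
        - shockEntropy (soundSpeed γ) l := by
  have ha := soundSpeed_pos hγ1
  have ha1 := soundSpeed_lt_one hγ2
  obtain ⟨k, hk⟩ := exists_waveJump_one hγ1 hγ2 hA hL w.physical_mid w.wave1
  obtain ⟨l, hl⟩ := exists_waveJump_three hγ1 hγ2 hA w.physical_mid' hR w.wave3
  obtain ⟨hr, hs⟩ := w.wave2.invariants hγ1 w.physical_mid w.physical_mid'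
  have hl4 := hl.ite_entropy ha ha1
  rw [abs_sub_comm] at hl4
  refine ⟨k, hk.mem, l, hl.mem, hk.strength_eq, hl.strength_eq, hk.ite_entropy ha ha1, hl4,
    ?_, ?_, ?_⟩
  · rw [eps1]
    linarith [hl.cross_eq]
  · rw [eps3]
    linarith [hk.cross_eq]
  · rw [delta]
    linarith [hk.entropy_eq, hl.entropy_eq]

end Waves

/-! ### Algebra of the coupling between the two families. -/

section Interaction

/-- If the decrease of the total shock strength `u` of one family is controlled by the decrease `w`
of the other one, and conversely, with constant `θ < 1`, then `u` is controlled by `u + w`. -/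
theorem two_mul_le_of_interaction {u w θ C X μ₁ μ₂ ν : ℝ} (hθ : θ < 1)
    (h₁ : 0 ≤ u ∨ -u ≤ μ₂ * w) (h₂ : 0 ≤ w ∨ -w ≤ μ₁ * u)
    (hμ₁ : 0 ≤ μ₁) (hμ₂ : 0 ≤ μ₂) (hμ₁' : μ₁ ≤ θ) (hμ₂' : μ₂ ≤ θ)
    (hν : 0 ≤ ν) (hνC : ν ≤ C) (hX : X ≤ ν * u) :
    2 * X ≤ 2 * C / (1 - θ) * (u + w) := by
  have hθ' : 0 < 1 - θ := by linarith
  rw [div_mul_eq_mul_div, le_div_iff₀ hθ']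
  -- If `u ≤ 0`, then `X ≤ 0` while `u + w ≥ 0`. If `u > 0`, then `w ≥ -θ * u`, so `u` is at most
  -- `(u + w) / (1 - θ)`.
  rcases le_or_gt u 0 with hu | hu
  · have huw : 0 ≤ u + w := by
      rcases h₁ with h₁ | h₁
      · rcases h₂ with h₂ | h₂ <;> nlinarith
      · have : 0 ≤ w := by
          rcases h₂ with h₂ | h₂
          · exact h₂
          · by_contra hw
            nlinarith
        nlinarith
    have : X ≤ 0 := hX.trans (mul_nonpos_of_nonneg_of_nonpos hν hu)
    have : 0 ≤ 2 * C * (u + w) := mul_nonneg (by linarith) huw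
    nlinarith
  · have huw : (1 - θ) * u ≤ u + w := by
      rcases h₂ with h₂ | h₂ <;> nlinarith
    have hXC : X ≤ C * u := hX.trans (mul_le_mul_of_nonneg_right hνC hu.le)
    nlinarith [mul_le_mul_of_nonneg_left huw (hν.trans hνC)]

/-- If the shock strength increases in an interaction, then by at most as much as the total change
`ε₁ + ε₂` exceeds the change `ε`. -/
theorem shock_increase_le {ε ε₁ ε₂ α α₁ α₂ : ℝ} (h : (if ε ≤ 0 then -ε else 0) = α)
    (h₁ : (if ε₁ ≤ 0 then -ε₁ else 0) = α₁) (h₂ : (if ε₂ ≤ 0 then -ε₂ else 0) = α₂) :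
    0 ≤ α₁ + α₂ - α ∨ -(α₁ + α₂ - α) ≤ ε₁ + ε₂ - ε := by
  subst h h₁ h₂
  -- The strength is the negative part of the signed change. The left alternative holds if `ε > 0`;
  -- otherwise `α = -ε`, and `αᵢ ≥ -εᵢ` gives the right one.
  split_ifs <;> first | (left; linarith) | (right; linarith)

end Interaction

end

/-! ### The interaction estimate. -/

theorem mainTheorem3 (γ : ℝ) (hγ1 : 1 < γ) (hγ2 : γ < 2) (Ω : Set (ℝ × ℝ)) (hΩ : IsCompact Ω) :
    ∃ M : ℝ, 0 < M ∧
      ∀ A : ℝ → ℝ, AdmissibleEOS A →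
      ∀ UL UM UR : FluidState, UL.Physical → UM.Physical → UR.Physical →
        (invR γ A UL, invS γ A UL) ∈ Ω →
        (invR γ A UM, invS γ A UM) ∈ Ω →
        (invR γ A UR, invS γ A UR) ∈ Ω →
      ∀ (w1 : RiemannSolution γ A UL UM) (w2 : RiemannSolution γ A UM UR)
        (w' : RiemannSolution γ A UL UR),
        |w'.delta| - |w1.delta| - |w2.delta|
            + (w1.deltaAlpha + w2.deltaAlpha - w'.deltaAlpha)
            + (w1.deltaBeta + w2.deltaBeta - w'.deltaBeta)
          ≤ -M * ((w'.alpha - w1.alpha - w2.alpha) + (w'.beta - w1.beta - w2.beta)) := by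
  have ha := soundSpeed_pos hγ1
  have ha1 := soundSpeed_lt_one hγ2
  have h1a : 1 < 1 / soundSpeed γ := by rwa [lt_div_iff₀ ha, one_mul]
  have hθ : ((1 / soundSpeed γ - 1) / (1 / soundSpeed γ + 1)) ^ 2 < 1 := by
    have h : (1 / soundSpeed γ - 1) / (1 / soundSpeed γ + 1) < 1 := by
      rw [div_lt_one (by linarith)]
      linarith
    have h0 : 0 ≤ (1 / soundSpeed γ - 1) / (1 / soundSpeed γ + 1) :=
      div_nonneg (by linarith) (by linarith)
    exact pow_lt_one₀ h0 h two_ne_zero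
  have hC : 0 < soundSpeed γ * (1 + soundSpeed γ ^ 2) / (1 - soundSpeed γ ^ 2) *
      ((1 / soundSpeed γ - 1) ^ 2 / (1 / soundSpeed γ)) := by
    have h2 : 0 < 1 - soundSpeed γ ^ 2 := by nlinarith
    have h3 : 0 < 1 / soundSpeed γ - 1 := by linarith
    positivity
  -- This is 2C/(1-θ), with C and θ the entropy and cross slopes at `k = 1/a`.
  refine ⟨2 * (soundSpeed γ * (1 + soundSpeed γ ^ 2) / (1 - soundSpeed γ ^ 2) *
      ((1 / soundSpeed γ - 1) ^ 2 / (1 / soundSpeed γ))) /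
      (1 - ((1 / soundSpeed γ - 1) / (1 / soundSpeed γ + 1)) ^ 2),
    div_pos (by linarith) (by linarith), ?_⟩
  intro A hA UL UM UR hL hM hR _ _ _ w1 w2 w'
  obtain ⟨k₁, hk₁, l₁, hl₁, ea₁, eb₁, eda₁, edb₁, er₁, es₁, eσ₁⟩ :=
    w1.exists_parameters hγ1 hγ2 hA hL hM
  obtain ⟨k₂, hk₂, l₂, hl₂, ea₂, eb₂, eda₂, edb₂, er₂, es₂, eσ₂⟩ :=
    w2.exists_parameters hγ1 hγ2 hA hM hR
  obtain ⟨k, hk, l, hl, ea, eb, eda, edb, er, es, eσ⟩ :=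
    w'.exists_parameters hγ1 hγ2 hA hL hR
  have inca := shock_increase_le (rfl : _ = w'.alpha) (rfl : _ = w1.alpha) (rfl : _ = w2.alpha)
  have incb := shock_increase_le (rfl : _ = w'.beta) (rfl : _ = w1.beta) (rfl : _ = w2.beta)
  obtain ⟨μ₁, hμ₁, hμ₁', hf₁⟩ := exists_slope_shockCross ha ha1 hk₁ hk₂ hk
  obtain ⟨μ₂, hμ₂, hμ₂', hf₂⟩ := exists_slope_shockCross ha ha1 hl₁ hl₂ hl
  obtain ⟨ν₁, hν₁, hν₁', hg₁⟩ := exists_slope_shockEntropy ha ha1 hk₁ hk₂ hk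
  obtain ⟨ν₂, hν₂, hν₂', hg₂⟩ := exists_slope_shockEntropy ha ha1 hl₁ hl₂ hl
  rw [← ea, ← ea₁, ← ea₂] at hf₁ hg₁
  rw [← eb, ← eb₁, ← eb₂] at hf₂ hg₂
  rw [← eda, ← eda₁, ← eda₂] at hg₁
  rw [← edb, ← edb₁, ← edb₂] at hg₂
  -- Adding up r from `UL` to `UR` identifies the excess of `eps1` with the excess of cross-jumps of
  -- the 3-shocks.
  have inca' := inca.imp_right fun h => h.trans ((by linarith :
    _ ≤ shockCross (soundSpeed γ) l₁ + shockCross (soundSpeed γ) l₂ -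
      shockCross (soundSpeed γ) l).trans hf₂)
  have incb' := incb.imp_right fun h => h.trans ((by linarith :
    _ ≤ shockCross (soundSpeed γ) k₁ + shockCross (soundSpeed γ) k₂ -
      shockCross (soundSpeed γ) k).trans hf₁)
  have b₁ := two_mul_le_of_interaction hθ inca' incb' hμ₁ hμ₂ hμ₁' hμ₂' hν₁ hν₁' hg₁
  have b₂ := two_mul_le_of_interaction hθ incb' inca' hμ₂ hμ₁ hμ₂' hμ₁' hν₂ hν₂' hg₂
  have hδ : w'.delta = w1.delta + w2.delta +
      ((w1.deltaAlpha + w2.deltaAlpha - w'.deltaAlpha) -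
        (w1.deltaBeta + w2.deltaBeta - w'.deltaBeta)) := by
    rw [eda, eda₁, eda₂, edb, edb₁, edb₂]
    linarith
  have habs : |w'.delta| ≤ |w1.delta| + |w2.delta| +
      |(w1.deltaAlpha + w2.deltaAlpha - w'.deltaAlpha) -
        (w1.deltaBeta + w2.deltaBeta - w'.deltaBeta)| :=
    hδ ▸ abs_add_three _ _ _
  -- As |X-Y| + X + Y is 2X or 2Y, one of `b₁`, `b₂` suffices in each case.
  rcases abs_cases ((w1.deltaAlpha + w2.deltaAlpha - w'.deltaAlpha) -
    (w1.deltaBeta + w2.deltaBeta - w'.deltaBeta)) with ⟨h, -⟩ | ⟨h, -⟩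
  · linarith
  · linarith
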